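/- Let $(\mathcal C,\mathbb E,\mathfrak s)$ be an extriangulated category (in the sense of Nakaoka and Palu) which admits all (set-indexed) coproducts and satisfies Condition (WIC): if a composite $gf$ is an inflation then so is $f$, and if $gf$ is a deflation then so is $g$. Let $\xi$ be a proper class of $\mathbb E$-triangles, i.e. a class of $\mathbb E$-triangles that is closed under isomorphisms, finite coproducts, base change and cobase change, contains all split $\mathbb E$-triangles, and is saturated: if $A_2\to B_2\xrightarrow{y_2} D\overset{\delta_2}{\dashrightarrow}$ and $A_1\to M\to B_2\overset{y_2^*\delta_1}{\dashrightarrow}$ lie in $\xi$, then so does $A_1\to B_1\to D\overset{\delta_1}{\dashrightarrow}$. An object $P$ is $\xi$-projective if $0\to\mathcal C(P,A)\to\mathcal C(P,B)\to\mathcal C(P,D)\to0$ is exact for each $\mathbb E$-triangle $A\to B\to D\dashrightarrow$ in $\xi$; $\xi$-injective objects are defined dually. Assume that $\mathcal C$ has enough $\xi$-projectives and enough $\xi$-injectives (every object $A$ admits $\mathbb E$-triangles $K\to P\to A\dashrightarrow$ and $A\to I\to L\dashrightarrow$ in $\xi$ with $P$ $\xi$-projective and $I$ $\xi$-injective), and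 that the class $\mathcal P(\xi)$ of $\xi$-projectives is generating: if $\mathcal C(P,A)=0$ for all $P\in\mathcal P(\xi)$, then $A=0$. Write $\xi\text{-pd}\,A\le 0$ if $A$ is $\xi$-projective, and $\xi\text{-pd}\,A\le n+1$ if there is an $\mathbb E$-triangle $K\to P\to A\dashrightarrow$ in $\xi$ with $P\in\mathcal P(\xi)$ and $\xi\text{-pd}\,K\le n$. A $\xi$-projective resolution of $M$ is a complex $\cdots\to P_1\to P_0\to M$ with all $P_n\in\mathcal P(\xi)$ obtained by splicing $\mathbb E$-triangles $K_{n+1}\to P_n\to K_n\dashrightarrow$ in $\xi$ ($n\ge0$, $K_0=M$), and $\xi xt^n_\xi(M,N)=H^n(\mathcal C(P_\bullet,N))$. For a class $\mathcal X$ of objects let ${}^\perp\mathcal X=\{K\mid \xi xt^1_\xi(K,X)=0\ \forall X\in\mathcal X\}$, and for an object $T$ let $T^\perp=\{Y\mid \xi xt^1_\xi(T,Y)=0\}$. Let $\mathrm{Add}\,T$ be the class of direct summands of coproducts of copies of $T$. A nonzero object $T$ is $\xi$-tilting if (T1) $\xi\text{-pd}\,T\le1$; (T2) $\xi xt^1_\xi(T,T^{(\lambda)})=0$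 for every cardinal $\lambda$; (T3) every $P\in\mathcal P(\xi)$ admits an $\mathbb E$-triangle $P\to T_0\to T_1\dashrightarrow$ in $\xi$ with $T_0,T_1\in\mathrm{Add}\,T$. Proposition. Let $T$ be $\xi$-tilting and $\mathcal X=T^\perp$. Then: (1) $\mathcal X$ is a special $\xi$-covariantly finite subcategory of $\mathcal C$: it is a full additive subcategory closed under isomorphisms, finite direct sums and direct summands, and for every $M\in\mathcal C$ there is an $\mathbb E$-triangle $M\to X_0\to K\dashrightarrow$ in $\xi$ with $X_0\in\mathcal X$ and $K\in{}^\perp\mathcal X$ such that the induced map $\mathcal C(X_0,X)\to\mathcal C(M,X)$ is surjective for every $X\in\mathcal X$. (2) Every $K\in{}^\perp\mathcal X$ satisfies $\xi\text{-pd}\,K\le1$. (3) If $X\to Y\to Z\dashrightarrow$ is an $\mathbb E$-triangle in $\xi$ with $X,Y\in\mathcal X$, then $Z\in\mathcal X$. -/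

import Mathlib

open CategoryTheory CategoryTheory.Limits Opposite

universe w v u

namespace Extri

section Sequences

variable {C : Type u} [Category.{v} C]

/-- A sequence `A ⟶ B ⟶ D` with fixed end terms `A` and `D`. -/
structure Seq (A D : C) where
  mid : C
  i : A ⟶ mid
  p : mid ⟶ D

/-- Two sequences are equivalent when an isomorphism of the middle terms is compatible with
the identities of the end terms. -/
def Seq.Equivalent {A D : C} (X Y : Seq A D) : Prop :=
  ∃ b : X.mid ≅ Y.mid, X.i ≫ b.hom = Y.i ∧ b.hom ≫ Y.p = X.p

instance seqSetoid (A D : C) : Setoid (Seq A D) where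
  r := Seq.Equivalent
  iseqv :=
    { refl := fun X => ⟨Iso.refl _, by simp, by simp⟩
      symm := by
        rintro X Y ⟨b, h₁, h₂⟩
        exact ⟨b.symm, by simp [← h₁], by simp [← h₂]⟩
      trans := by
        rintro X Y Z ⟨b, h₁, h₂⟩ ⟨b', h₃, h₄⟩
        exact ⟨b ≪≫ b', by simp [reassoc_of% h₁, h₃], by simp [h₄, h₂]⟩ }

/-- Equivalence classes of sequences `A ⟶ B ⟶ D`. -/
abbrev SeqClass (A D : C) : Type (max u v) := Quotient (seqSetoid A D)

/-- The class of the sequence `A ⟶ B ⟶ D`. -/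
def seqClass {A B D : C} (x : A ⟶ B) (y : B ⟶ D) : SeqClass A D :=
  Quotient.mk _ ⟨B, x, y⟩

end Sequences

section Extensions

variable {C : Type u} [Category.{v} C]

/-- The group `𝔼(D, A)` of `𝔼`-extensions. -/
abbrev Extn (E : Cᵒᵖ ⥤ C ⥤ AddCommGrpCat.{w}) (D A : C) : Type w := ((E.obj (op D)).obj A : Type w)

/-- `a_* δ`. -/
def push (E : Cᵒᵖ ⥤ C ⥤ AddCommGrpCat.{w}) {D A A' : C} (a : A ⟶ A') (δ : Extn E D A) :
    Extn E D A' :=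
  ((E.obj (op D)).map a).hom δ

/-- `c^* δ`. -/
def pull (E : Cᵒᵖ ⥤ C ⥤ AddCommGrpCat.{w}) {D D' A : C} (c : D' ⟶ D) (δ : Extn E D A) :
    Extn E D' A :=
  ((E.map c.op).app A).hom δ

/-- The direct sum `δ ⊕ δ'`, i.e. the element of `𝔼(D ⊞ D', A ⊞ A')` with components
`(δ, 0, 0, δ')`. -/
noncomputable def extSum [Preadditive C] [HasBinaryBiproducts C]
    (E : Cᵒᵖ ⥤ C ⥤ AddCommGrpCat.{w}) {D A D' A' : C}
    (δ : Extn E D A) (δ' : Extn E D' A') : Extn E (D ⊞ D') (A ⊞ A') :=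
  push E biprod.inl (pull E biprod.fst δ) + push E biprod.inr (pull E biprod.snd δ')

end Extensions

end Extri

open Extri

/-- The structure `(𝔼, 𝔰)` of an extriangulated category on an additive category `C`
(Nakaoka and Palu). -/
structure Extriangulation (C : Type u) [Category.{v} C] [Preadditive C]
    [HasZeroObject C] [HasBinaryBiproducts C] where
  /-- (ET1): a biadditive functor `𝔼`. -/
  E : Cᵒᵖ ⥤ C ⥤ AddCommGrpCat.{w}
  additive_left : E.Additive
  additive_right : ∀ X : Cᵒᵖ, (E.obj X).Additive
  /-- The realization `𝔰`. -/
  s : ∀ {D A : C}, Extn E D A → SeqClass A D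
  /-- (ET2), `𝔰` is a realization: every morphism of extensions is realized. -/
  realize : ∀ {A B D A' B' D' : C} (x : A ⟶ B) (y : B ⟶ D) (x' : A' ⟶ B') (y' : B' ⟶ D')
    (δ : Extn E D A) (δ' : Extn E D' A') (a : A ⟶ A') (c : D ⟶ D'),
    s δ = seqClass x y → s δ' = seqClass x' y' → push E a δ = pull E c δ' →
    ∃ b : B ⟶ B', x ≫ b = a ≫ x' ∧ y ≫ c = b ≫ y'
  /-- (ET2), additivity of `𝔰`. -/
  s_zero : ∀ A D : C,
    s (0 : Extn E D A) = seqClass (biprod.inl : A ⟶ A ⊞ D) (biprod.snd : A ⊞ D ⟶ D)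
  s_sum : ∀ {A B D A' B' D' : C} (x : A ⟶ B) (y : B ⟶ D) (x' : A' ⟶ B') (y' : B' ⟶ D')
    (δ : Extn E D A) (δ' : Extn E D' A'),
    s δ = seqClass x y → s δ' = seqClass x' y' →
    s (extSum E δ δ') = seqClass (biprod.map x x') (biprod.map y y')
  /-- (ET3). -/
  et3 : ∀ {A B D A' B' D' : C} (x : A ⟶ B) (y : B ⟶ D) (x' : A' ⟶ B') (y' : B' ⟶ D')
    (δ : Extn E D A) (δ' : Extn E D' A') (a : A ⟶ A') (b : B ⟶ B'),
    s δ = seqClass x y → s δ' = seqClass x' y' → x ≫ b = a ≫ x' →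
    ∃ c : D ⟶ D', y ≫ c = b ≫ y' ∧ push E a δ = pull E c δ'
  /-- (ET3)ᵒᵖ. -/
  et3_op : ∀ {A B D A' B' D' : C} (x : A ⟶ B) (y : B ⟶ D) (x' : A' ⟶ B') (y' : B' ⟶ D')
    (δ : Extn E D A) (δ' : Extn E D' A') (b : B ⟶ B') (c : D ⟶ D'),
    s δ = seqClass x y → s δ' = seqClass x' y' → y ≫ c = b ≫ y' →
    ∃ a : A ⟶ A', x ≫ b = a ≫ x' ∧ push E a δ = pull E c δ'
  /-- (ET4). -/
  et4 : ∀ {A B D G F : C} (f : A ⟶ B) (f' : B ⟶ D) (g : B ⟶ G) (g' : G ⟶ F)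
    (δ : Extn E D A) (δ' : Extn E F B),
    s δ = seqClass f f' → s δ' = seqClass g g' →
    ∃ (H : C) (d : D ⟶ H) (e : H ⟶ F) (h : A ⟶ G) (h' : G ⟶ H) (δ'' : Extn E H A),
      f ≫ g = h ∧ f' ≫ d = g ≫ h' ∧ h' ≫ e = g' ∧
      s δ'' = seqClass h h' ∧
      s (push E f' δ') = seqClass d e ∧
      pull E d δ'' = δ ∧
      push E f δ'' = pull E e δ'
  /-- (ET4)ᵒᵖ. -/
  et4_op : ∀ {A B D G F : C} (f' : D ⟶ A) (f : A ⟶ B) (g' : F ⟶ B) (g : B ⟶ G)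
    (δ : Extn E B D) (δ' : Extn E G F),
    s δ = seqClass f' f → s δ' = seqClass g' g →
    ∃ (H : C) (d : D ⟶ H) (e : H ⟶ F) (h' : H ⟶ A) (h : A ⟶ G) (δ'' : Extn E G H),
      f ≫ g = h ∧ d ≫ h' = f' ∧ e ≫ g' = h' ≫ f ∧
      s δ'' = seqClass h' h ∧
      s (pull E g' δ) = seqClass d e ∧
      push E e δ'' = δ' ∧
      push E d δ = pull E g δ''

namespace Extriangulation

section Basic

variable {C : Type u} [Category.{v} C] [Preadditive C] [HasZeroObject C] [HasBinaryBiproducts C]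
variable (S : Extriangulation.{w} C)

/-- `A ⟶ B ⟶ D ⇢` with extension `δ` is an `𝔼`-triangle. -/
def IsTriangle {A B D : C} (x : A ⟶ B) (y : B ⟶ D) (δ : Extn S.E D A) : Prop :=
  S.s δ = seqClass x y

def IsInflation {A B : C} (x : A ⟶ B) : Prop :=
  ∃ (D : C) (y : B ⟶ D) (δ : Extn S.E D A), S.IsTriangle x y δ

def IsDeflation {B D : C} (y : B ⟶ D) : Prop :=
  ∃ (A : C) (x : A ⟶ B) (δ : Extn S.E D A), S.IsTriangle x y δ

/-- Condition (WIC). -/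
structure WIC : Prop where
  inflation : ∀ {A B D : C} (f : A ⟶ B) (g : B ⟶ D), S.IsInflation (f ≫ g) → S.IsInflation f
  deflation : ∀ {A B D : C} (f : A ⟶ B) (g : B ⟶ D), S.IsDeflation (f ≫ g) → S.IsDeflation g

/-- A proper class `ξ` of `𝔼`-triangles. -/
structure ProperClass where
  mem : ∀ {A B D : C}, (A ⟶ B) → (B ⟶ D) → Extn S.E D A → Prop
  isTriangle : ∀ {A B D : C} {x : A ⟶ B} {y : B ⟶ D} {δ : Extn S.E D A},
    mem x y δ → S.IsTriangle x y δ
  /-- Closure under isomorphisms of `𝔼`-triangles. -/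
  mem_of_iso : ∀ {A B D A' B' D' : C} {x : A ⟶ B} {y : B ⟶ D} {δ : Extn S.E D A}
    {x' : A' ⟶ B'} {y' : B' ⟶ D'} {δ' : Extn S.E D' A'} (a : A ≅ A') (b : B ≅ B') (c : D ≅ D'),
    mem x y δ → S.IsTriangle x' y' δ' → x ≫ b.hom = a.hom ≫ x' → y ≫ c.hom = b.hom ≫ y' →
    push S.E a.hom δ = pull S.E c.hom δ' → mem x' y' δ'
  /-- Closure under (binary, hence nonempty finite) coproducts. The empty coproduct is split. -/
  mem_sum : ∀ {A B D A' B' D' : C} {x : A ⟶ B} {y : B ⟶ D} {δ : Extn S.E D A}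
    {x' : A' ⟶ B'} {y' : B' ⟶ D'} {δ' : Extn S.E D' A'},
    mem x y δ → mem x' y' δ' → mem (biprod.map x x') (biprod.map y y') (extSum S.E δ δ')
  /-- All split `𝔼`-triangles belong to `ξ`. -/
  mem_split : ∀ {A B D : C} {x : A ⟶ B} {y : B ⟶ D},
    S.IsTriangle x y (0 : Extn S.E D A) → mem x y (0 : Extn S.E D A)
  base_change : ∀ {A B D B' D' : C} {x : A ⟶ B} {y : B ⟶ D} {δ : Extn S.E D A} (c : D' ⟶ D)
    {x' : A ⟶ B'} {y' : B' ⟶ D'},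
    mem x y δ → S.IsTriangle x' y' (pull S.E c δ) → mem x' y' (pull S.E c δ)
  cobase_change : ∀ {A B D A' B' : C} {x : A ⟶ B} {y : B ⟶ D} {δ : Extn S.E D A} (a : A ⟶ A')
    {x' : A' ⟶ B'} {y' : B' ⟶ D},
    mem x y δ → S.IsTriangle x' y' (push S.E a δ) → mem x' y' (push S.E a δ)
  /-- Saturation: if `δ₂` and the base change of `δ₁` along the deflation of `δ₂` belong to `ξ`,
  then so does `δ₁`. -/
  saturated : ∀ {A₁ B₁ A₂ B₂ D M : C} {x₁ : A₁ ⟶ B₁} {y₁ : B₁ ⟶ D} {δ₁ : Extn S.E D A₁}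
    {x₂ : A₂ ⟶ B₂} {y₂ : B₂ ⟶ D} {δ₂ : Extn S.E D A₂} {m₁ : A₁ ⟶ M} {e₁ : M ⟶ B₂},
    S.IsTriangle x₁ y₁ δ₁ → mem x₂ y₂ δ₂ → mem m₁ e₁ (pull S.E y₂ δ₁) → mem x₁ y₁ δ₁

end Basic

namespace ProperClass

section Homological

variable {C : Type u} [Category.{v} C] [Preadditive C] [HasZeroObject C] [HasBinaryBiproducts C]
variable {S : Extriangulation.{w} C} (ξ : S.ProperClass)

/-- `P` is `ξ`-projective: `0 → C(P, A) → C(P, B) → C(P, D) → 0` is exact for every `𝔼`-triangle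
`A ⟶ B ⟶ D ⇢` in `ξ`. -/
def IsProjective (P : C) : Prop :=
  ∀ {A B D : C} (x : A ⟶ B) (y : B ⟶ D) (δ : Extn S.E D A), ξ.mem x y δ →
    Function.Injective (fun f : P ⟶ A => f ≫ x) ∧
    Function.Exact (fun f : P ⟶ A => f ≫ x) (fun g : P ⟶ B => g ≫ y) ∧
    Function.Surjective (fun g : P ⟶ B => g ≫ y)

/-- `I` is `ξ`-injective: `0 → C(D, I) → C(B, I) → C(A, I) → 0` is exact for every `𝔼`-triangle
`A ⟶ B ⟶ D ⇢` in `ξ`. -/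
def IsInjective (I : C) : Prop :=
  ∀ {A B D : C} (x : A ⟶ B) (y : B ⟶ D) (δ : Extn S.E D A), ξ.mem x y δ →
    Function.Injective (fun f : D ⟶ I => y ≫ f) ∧
    Function.Exact (fun f : D ⟶ I => y ≫ f) (fun g : B ⟶ I => x ≫ g) ∧
    Function.Surjective (fun g : B ⟶ I => x ≫ g)

def EnoughProjectives : Prop :=
  ∀ A : C, ∃ (K P : C) (x : K ⟶ P) (y : P ⟶ A) (δ : Extn S.E A K),
    ξ.mem x y δ ∧ ξ.IsProjective P

def EnoughInjectives : Prop :=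
  ∀ A : C, ∃ (I K : C) (x : A ⟶ I) (y : I ⟶ K) (δ : Extn S.E K A),
    ξ.mem x y δ ∧ ξ.IsInjective I

/-- The `ξ`-projectives form a generating subcategory: an object that receives only zero
morphisms from `ξ`-projectives is zero. -/
def ProjectivesGenerate : Prop :=
  ∀ A : C, (∀ P : C, ξ.IsProjective P → ∀ f : P ⟶ A, f = 0) → IsZero A

/-- `ξ`-pd `A ≤ n`. -/
def PdLE : ℕ → C → Prop
  | 0, A => ξ.IsProjective A
  | n + 1, A => ∃ (K P : C) (x : K ⟶ P) (y : P ⟶ A) (δ : Extn S.E A K),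
      ξ.mem x y δ ∧ ξ.IsProjective P ∧ PdLE n K

/-- A `ξ`-projective resolution `⋯ ⟶ P 1 ⟶ P 0 ⟶ M`, with its syzygies: `𝔼`-triangles
`K 0 ⟶ P 0 ⟶ M ⇢` and `K (n + 1) ⟶ P (n + 1) ⟶ K n ⇢` in `ξ` with all `P n`
`ξ`-projective. -/
structure ProjRes (M : C) where
  P : ℕ → C
  K : ℕ → C
  projective : ∀ n, ξ.IsProjective (P n)
  i : ∀ n, K n ⟶ P n
  augm : P 0 ⟶ M
  δ_augm : Extn S.E M (K 0)
  mem_augm : ξ.mem (i 0) augm δ_augm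
  p : ∀ n, P (n + 1) ⟶ K n
  δ : ∀ n, Extn S.E (K n) (K (n + 1))
  mem_p : ∀ n, ξ.mem (i (n + 1)) (p n) (δ n)

/-- Resolutions exist when there are enough `ξ`-projectives. -/
theorem ProjRes.nonempty_of_enough (h : ξ.EnoughProjectives) (M : C) :
    Nonempty (ξ.ProjRes M) := by
  choose K P x y δ hmem hP using h
  let L : ℕ → C := fun n => Nat.rec (K M) (fun _ X => K X) n
  let Q : ℕ → C := fun n => Nat.casesOn n (P M) (fun m => P (L m))
  exact ⟨{
    P := Q
    K := L
    projective := fun n => by cases n <;> exact hP _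
    i := fun n => Nat.casesOn n (x M) (fun m => x (L m))
    augm := y M
    δ_augm := δ M
    mem_augm := hmem M
    p := fun n => y (L n)
    δ := fun n => δ (L n)
    mem_p := fun n => hmem (L n) }⟩

variable {ξ}

/-- The differential `P (n + 1) ⟶ K n ⟶ P n`. -/
def ProjRes.d {M : C} (R : ξ.ProjRes M) (n : ℕ) : R.P (n + 1) ⟶ R.P n := R.p n ≫ R.i n

/-- The `n`-cocycles of the complex `C(P, N)`. -/
def ProjRes.cocycles {M : C} (R : ξ.ProjRes M) (N : C) (n : ℕ) : AddSubgroup (R.P n ⟶ N) :=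
  (Preadditive.leftComp N (R.d n)).ker

/-- The `n`-coboundaries of the complex `C(P, N)`. -/
def ProjRes.coboundaries {M : C} (R : ξ.ProjRes M) (N : C) : ∀ n : ℕ, AddSubgroup (R.P n ⟶ N)
  | 0 => ⊥
  | n + 1 => (Preadditive.leftComp N (R.d n)).range

/-- The group `ξxtⁿ(M, N) = Hⁿ(C(P, N))`, computed with the resolution `P = R` of `M`. -/
abbrev ProjRes.Xt {M : C} (R : ξ.ProjRes M) (N : C) (n : ℕ) : Type v :=
  R.cocycles N n ⧸ (R.coboundaries N n).addSubgroupOf (R.cocycles N n)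

variable (ξ)

/-- `ξxtⁿ(M, N) = 0`. These groups do not depend on the resolution up to isomorphism. -/
def XtZero (n : ℕ) (M N : C) : Prop :=
  ∀ R : ξ.ProjRes M, Subsingleton (R.Xt N n)

/-- `𝒳^⊥`. -/
def rightPerp (𝒳 : ObjectProperty C) : ObjectProperty C :=
  fun Y => ∀ X : C, 𝒳 X → ξ.XtZero 1 X Y

/-- `^⊥𝒴`. -/
def leftPerp (𝒴 : ObjectProperty C) : ObjectProperty C :=
  fun X => ∀ Y : C, 𝒴 Y → ξ.XtZero 1 X Y

/-- `T^⊥` for a single object. -/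
def perp (T : C) : ObjectProperty C := ξ.rightPerp (fun X => X = T)

end Homological

section Tilting

variable {C : Type u} [Category.{v} C] [Preadditive C] [HasZeroObject C] [HasBinaryBiproducts C]

/-- `𝒳` is (the object class of) a full additive subcategory closed under isomorphisms, direct
sums and direct summands. -/
structure IsSubcategory (𝒳 : ObjectProperty C) : Prop where
  zero : ∀ Z : C, IsZero Z → 𝒳 Z
  iso : ∀ {X Y : C}, (X ≅ Y) → 𝒳 X → 𝒳 Y
  sum : ∀ {X Y : C}, 𝒳 X → 𝒳 Y → 𝒳 (X ⊞ Y)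
  summand : ∀ {X Y : C}, 𝒳 (X ⊞ Y) → 𝒳 X

variable {S : Extriangulation.{w} C} (ξ : S.ProperClass)

/-- `𝒳` is a special `ξ`-covariantly finite subcategory. -/
structure IsSpecialCovariantlyFinite (𝒳 : ObjectProperty C) : Prop where
  isSubcategory : IsSubcategory 𝒳
  exists_triangle : ∀ M : C, ∃ (X₀ K : C) (x : M ⟶ X₀) (y : X₀ ⟶ K) (δ : Extn S.E K M),
    ξ.mem x y δ ∧ 𝒳 X₀ ∧
    (∀ X : C, 𝒳 X → Function.Surjective (fun f : X₀ ⟶ X => x ≫ f)) ∧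
    ξ.leftPerp 𝒳 K

/-- `Add T`: the direct summands of coproducts of copies of `T`. -/
def Add [HasCoproducts.{v} C] (T : C) : ObjectProperty C :=
  fun M => ∃ (J : Type v) (N : C), Nonempty (M ⊞ N ≅ ∐ fun _ : J => T)

/-- `T` is a `ξ`-tilting object. -/
structure IsTilting [HasCoproducts.{v} C] (T : C) : Prop where
  nonzero : ¬ IsZero T
  pd_le_one : ξ.PdLE 1 T
  self_orthogonal : ∀ J : Type v, ξ.XtZero 1 T (∐ fun _ : J => T)
  coresolution : ∀ P : C, ξ.IsProjective P →
    ∃ (T₀ T₁ : C) (x : P ⟶ T₀) (y : T₀ ⟶ T₁) (δ : Extn S.E T₁ P),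
      ξ.mem x y δ ∧ Add T T₀ ∧ Add T T₁

end Tilting

end ProperClass

end Extriangulation

/-! Fix a `ξ`-triangle `P₁ ⟶ P₀ ⟶ T ⇢` with `P₁`, `P₀` `ξ`-projective. Then `Y` lies in `T^⊥` iff
every morphism `P₁ ⟶ Y` extends along `i : P₁ ⟶ P₀` (`perp_iff`). Closure under summands and
`ξ`-quotients is then a diagram chase, which gives (3).

For (1), take the coproduct of copies of this presentation indexed by all morphisms `P₁ ⟶ M` and
push it out along the evaluation map to `M`, obtaining `M ⟶ X₀ ⟶ ∐ T ⇢`. By (T2), a morphism `P₁ ⟶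
X₀` can be corrected by one that extends to `P₀` so as to factor through `M`; it is then one of the
indices, so it extends by construction.

For (2), embed the second syzygy of `K` in an injective `I`. The quotient of `I` lies in `T^⊥`, so
`ξxt¹` from `K` to it vanishes. This splits the second syzygy off `P 1` and makes the first syzygy
projective.

The obstacle is that `ξ`-inflations need not be monomorphisms and coproducts of triangles are not
given to be triangles. Both are handled by detecting isomorphisms on `ξ`-projectives or
`ξ`-injectives (`isIso_of_bijective_projective`, `isIso_of_bijective_injective`), which yields
`exists_mem_sigma`. -/

namespace Extri

section Functoriality

variable {C : Type u} [Category.{v} C] (E : Cᵒᵖ ⥤ C ⥤ AddCommGrpCat.{w})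

theorem push_id {D A : C} (δ : Extn E D A) : push E (𝟙 A) δ = δ := by simp [push]

theorem pull_id {D A : C} (δ : Extn E D A) : pull E (𝟙 D) δ = δ := by simp [pull]

theorem push_comp {D A A' A'' : C} (a : A ⟶ A') (a' : A' ⟶ A'') (δ : Extn E D A) :
    push E (a ≫ a') δ = push E a' (push E a δ) := by simp [push]

theorem push_zero {D A A' : C} (a : A ⟶ A') : push E a (0 : Extn E D A) = 0 := by
  simp [push]

theorem pull_zero {D D' A : C} (c : D' ⟶ D) : pull E c (0 : Extn E D A) = 0 := by
  simp [pull]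

theorem pull_comp {D D' D'' A : C} (c : D' ⟶ D) (c' : D'' ⟶ D') (δ : Extn E D A) :
    pull E (c' ≫ c) δ = pull E c' (pull E c δ) := by simp [pull]

end Functoriality

end Extri

namespace Extriangulation

/-! ### Exactness properties of `𝔼`-triangles. -/

section Exactness

variable {C : Type u} [Category.{v} C] [Preadditive C] [HasZeroObject C] [HasBinaryBiproducts C]
variable {S : Extriangulation.{w} C}

theorem exists_isTriangle (S : Extriangulation.{w} C) {D A : C} (δ : Extn S.E D A) :
    ∃ (B : C) (x : A ⟶ B) (y : B ⟶ D), S.IsTriangle x y δ := by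
  obtain ⟨⟨B, x, y⟩, h⟩ := Quotient.exists_rep (S.s δ)
  exact ⟨B, x, y, h.symm⟩

namespace IsTriangle

variable {A B D : C} {x : A ⟶ B} {y : B ⟶ D} {δ : Extn S.E D A}

/-- This and the next exactness lemmas come from comparing the triangle with a split one through
(ET2), (ET3) or its dual. -/
theorem comp_eq_zero (h : S.IsTriangle x y δ) : x ≫ y = 0 := by
  obtain ⟨c, hc, -⟩ := S.et3 _ _ _ _ _ _ (𝟙 A) (biprod.fst ≫ x) (S.s_zero A A) h (by simp)
  have := biprod.inl ≫= hc
  simpa using this.symm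

theorem exists_lift (h : S.IsTriangle x y δ) {W : C} (f : W ⟶ B) (hf : f ≫ y = 0) :
    ∃ g : W ⟶ A, g ≫ x = f := by
  obtain ⟨a, ha, -⟩ := S.et3_op _ _ _ _ _ _ (biprod.fst ≫ f) (0 : W ⟶ D) (S.s_zero W W) h
    (by simp [hf])
  exact ⟨a, by simpa using ha.symm⟩

theorem exists_desc (h : S.IsTriangle x y δ) {W : C} (g : B ⟶ W) (hg : x ≫ g = 0) :
    ∃ c : D ⟶ W, y ≫ c = g := by
  obtain ⟨c, hc, -⟩ := S.et3 _ _ _ _ _ _ (0 : A ⟶ W) (g ≫ biprod.inr) h (S.s_zero W W)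
    (by simp [reassoc_of% hg])
  exact ⟨c, by simpa using hc⟩

theorem push_eq_zero (h : S.IsTriangle x y δ) : push S.E x δ = 0 := by
  obtain ⟨c, -, hc⟩ := S.et3 _ _ _ _ _ _ x biprod.inl h (S.s_zero B B) rfl
  rw [hc, pull_zero]

theorem exists_extend (h : S.IsTriangle x y δ) {W : C} (a : A ⟶ W) (ha : push S.E a δ = 0) :
    ∃ g : B ⟶ W, x ≫ g = a := by
  obtain ⟨b, hb, -⟩ := S.realize _ _ _ _ _ _ a (0 : D ⟶ W) h (S.s_zero W W)
    (by rw [ha, pull_zero])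
  exact ⟨b ≫ biprod.fst, by simp [reassoc_of% hb]⟩

theorem exists_colift (h : S.IsTriangle x y δ) {W : C} (c : W ⟶ D) (hc : pull S.E c δ = 0) :
    ∃ g : W ⟶ B, g ≫ y = c := by
  obtain ⟨b, -, hb⟩ := S.realize _ _ _ _ _ _ (0 : W ⟶ A) c (S.s_zero W W) h
    (by rw [hc, push_zero])
  exact ⟨biprod.inr ≫ b, by simp [← hb]⟩

theorem push_extend (h : S.IsTriangle x y δ) {W : C} (g : B ⟶ W) :
    push S.E (x ≫ g) δ = 0 := by
  rw [push_comp, h.push_eq_zero, push_zero]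

/-- A triangle whose inflation is a split monomorphism splits. -/
theorem exists_section (h : S.IsTriangle x y δ) {r : B ⟶ A} (hr : x ≫ r = 𝟙 A) :
    ∃ s : D ⟶ B, s ≫ y = 𝟙 D := by
  refine h.exists_colift (𝟙 D) ?_
  rw [pull_id, ← push_id S.E δ, ← hr, h.push_extend]

/-- An isomorphism onto the third term transports a triangle. -/
theorem of_iso_right (h : S.IsTriangle x y δ) {D' : C} (c : D' ≅ D) :
    S.IsTriangle x (y ≫ c.inv) (pull S.E c.hom δ) := by
  obtain ⟨B', x', y', h'⟩ := S.exists_isTriangle (pull S.E c.hom δ)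
  obtain ⟨b, hb₁, hb₂⟩ := S.realize _ _ _ _ _ _ (𝟙 A) c.hom h' h (by rw [push_id])
  obtain ⟨b', hb'₁, hb'₂⟩ := S.realize _ _ _ _ _ _ (𝟙 A) c.inv h h'
    (by rw [push_id, ← pull_comp, Iso.inv_hom_id, pull_id])
  rw [Category.id_comp] at hb₁ hb'₁
  -- An endomorphism of a triangle which is the identity on the ends is unipotent.
  have unipotent : ∀ {M E' : C} {i : A ⟶ M} {p : M ⟶ E'} {ε : Extn S.E E' A},
      S.IsTriangle i p ε → ∀ e : M ⟶ M, i ≫ e = i → e ≫ p = p → IsIso e := by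
    intro M E' i p ε hε e h₁ h₂
    obtain ⟨t, ht⟩ := hε.exists_lift (e - 𝟙 M) (by simp [h₂])
    have h0 : (e - 𝟙 M) ≫ (e - 𝟙 M) = 0 := by
      rw [← ht, Category.assoc, ht, Preadditive.comp_sub, h₁]; simp
    have h0' : e ≫ e = e + e - 𝟙 M := by
      simp only [Preadditive.comp_sub, Preadditive.sub_comp, Category.comp_id,
        Category.id_comp] at h0
      have := sub_eq_zero.mp h0
      rw [sub_eq_iff_eq_add] at this
      rw [this]; abel
    -- Since `(e - 𝟙)² = 0`, the inverse of `e` is `𝟙 - (e - 𝟙)`.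
    refine ⟨𝟙 M + 𝟙 M - e, ?_, ?_⟩ <;>
      simp only [Preadditive.comp_sub, Preadditive.sub_comp, Preadditive.comp_add,
        Preadditive.add_comp, Category.comp_id, Category.id_comp, h0'] <;> abel
  have u₁ : IsIso (b ≫ b') := unipotent h' _ (by rw [reassoc_of% hb₁, hb'₁]) (by
    rw [Category.assoc, ← hb'₂, ← reassoc_of% hb₂]; simp)
  have u₂ : IsIso (b' ≫ b) := unipotent h _ (by rw [reassoc_of% hb'₁, hb₁]) (by
    rw [Category.assoc, ← hb₂, ← reassoc_of% hb'₂]; simp)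
  have : IsIso b := by
    have m : IsSplitMono b := ⟨⟨⟨b' ≫ inv (b ≫ b'), by rw [← Category.assoc]; simp⟩⟩⟩
    have e : IsSplitEpi b := ⟨⟨⟨inv (b' ≫ b) ≫ b', by rw [Category.assoc]; simp⟩⟩⟩
    exact isIso_of_mono_of_isSplitEpi b
  refine Eq.trans h' (Quotient.sound ⟨asIso b, hb₁, ?_⟩)
  simp [← reassoc_of% hb₂]

end IsTriangle

end Exactness

namespace ProperClass

/-! ### Cancellation for `ξ`-inflations and `ξ`-deflations. -/

section Cancellation

variable {C : Type u} [Category.{v} C] [Preadditive C] [HasZeroObject C] [HasBinaryBiproducts C]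
variable {S : Extriangulation.{w} C} {ξ : S.ProperClass}

theorem mem_of_iso_right {A B D D' : C} {x : A ⟶ B} {y : B ⟶ D} {δ : Extn S.E D A}
    (h : ξ.mem x y δ) (c : D' ≅ D) : ξ.mem x (y ≫ c.inv) (pull S.E c.hom δ) :=
  ξ.base_change c.hom h ((ξ.isTriangle h).of_iso_right c)

/-- If `f ≫ g` is a `ξ`-inflation, then so is `f`. -/
theorem exists_mem_of_comp_inflation (hWIC : S.WIC) {A B G D : C} (f : A ⟶ B) (g : B ⟶ G)
    {y : G ⟶ D} {δ : Extn S.E D A} (h : ξ.mem (f ≫ g) y δ) :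
    ∃ (D' : C) (y' : B ⟶ D') (δ' : Extn S.E D' A), ξ.mem f y' δ' := by
  obtain ⟨D', y', δ', h'⟩ := hWIC.inflation f g ⟨D, y, δ, ξ.isTriangle h⟩
  -- A morphism of triangles that is the identity on `A` exhibits `δ'` as a base change of `δ`.
  obtain ⟨c, -, hc⟩ := S.et3 _ _ _ _ _ _ (𝟙 A) g h' (ξ.isTriangle h) (by simp)
  rw [push_id] at hc
  subst hc
  exact ⟨D', y', _, ξ.base_change c h h'⟩

/-- If `f ≫ g` is a `ξ`-deflation, then so is `g`. -/
theorem exists_mem_of_comp_deflation (hWIC : S.WIC) {A B G D : C} (f : B ⟶ G) (g : G ⟶ D)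
    {x : A ⟶ B} {δ : Extn S.E D A} (h : ξ.mem x (f ≫ g) δ) :
    ∃ (A' : C) (x' : A' ⟶ G) (δ' : Extn S.E D A'), ξ.mem x' g δ' := by
  obtain ⟨A', x', δ', h'⟩ := hWIC.deflation f g ⟨A, x, δ, ξ.isTriangle h⟩
  obtain ⟨a, -, ha⟩ := S.et3_op _ _ _ _ _ _ f (𝟙 D) (ξ.isTriangle h) h' (by simp)
  rw [pull_id] at ha
  subst ha
  exact ⟨A', x', _, ξ.cobase_change a h h'⟩

/-- Split epimorphisms are `ξ`-deflations. -/
theorem exists_mem_of_section (hWIC : S.WIC) {B D : C} (q : B ⟶ D) (r : D ⟶ B)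
    (h : r ≫ q = 𝟙 D) :
    ∃ (A : C) (x : A ⟶ B) (δ : Extn S.E D A), ξ.mem x q δ := by
  have hs := ξ.mem_split (S.s_zero D D)
  refine exists_mem_of_comp_deflation hWIC (biprod.snd ≫ r) q (x := (biprod.inl : D ⟶ D ⊞ D)) (δ := 0) ?_
  simpa [h] using hs

/-- Split monomorphisms are `ξ`-inflations. -/
theorem exists_mem_of_retraction (hWIC : S.WIC) {A B : C} (q : A ⟶ B) (r : B ⟶ A)
    (h : q ≫ r = 𝟙 A) :
    ∃ (D : C) (y : B ⟶ D) (δ : Extn S.E D A), ξ.mem q y δ := by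
  have hs := ξ.mem_split (S.s_zero A A)
  refine exists_mem_of_comp_inflation hWIC q (r ≫ biprod.inl) (y := (biprod.snd : A ⊞ A ⟶ A)) (δ := 0) ?_
  simpa [reassoc_of% h] using hs

end Cancellation

/-! ### `ξ`-projectives and `ξ`-injectives. -/

section Projective

variable {C : Type u} [Category.{v} C] [Preadditive C] [HasZeroObject C] [HasBinaryBiproducts C]
variable {S : Extriangulation.{w} C} {ξ : S.ProperClass}

/-- Exactness in the middle is automatic for every `𝔼`-triangle, so only the two ends need checking.
-/
theorem isProjective_iff {P : C} : ξ.IsProjective P ↔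
    ∀ {A B D : C} {x : A ⟶ B} {y : B ⟶ D} {δ : Extn S.E D A}, ξ.mem x y δ →
      (∀ f : P ⟶ A, f ≫ x = 0 → f = 0) ∧ ∀ g : P ⟶ D, ∃ f : P ⟶ B, f ≫ y = g := by
  constructor
  · intro h A B D x y δ hm
    obtain ⟨h₁, -, h₃⟩ := h x y δ hm
    exact ⟨fun f hf => h₁ (by simpa using hf), h₃⟩
  · intro h A B D x y δ hm
    refine ⟨fun f g hfg => ?_, fun f => ⟨fun hf => ?_, ?_⟩, (h hm).2⟩
    · exact sub_eq_zero.mp ((h hm).1 _ (by simpa [sub_eq_zero] using hfg))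
    · exact (ξ.isTriangle hm).exists_lift f hf
    · rintro ⟨g, rfl⟩
      simp [(ξ.isTriangle hm).comp_eq_zero]

namespace IsProjective

variable {P A B D : C} {x : A ⟶ B} {y : B ⟶ D} {δ : Extn S.E D A}

theorem eq_zero (hP : ξ.IsProjective P) (h : ξ.mem x y δ) (f : P ⟶ A) (hf : f ≫ x = 0) :
    f = 0 :=
  (isProjective_iff.mp hP h).1 f hf

theorem exists_lift (hP : ξ.IsProjective P) (h : ξ.mem x y δ) (g : P ⟶ D) :
    ∃ f : P ⟶ B, f ≫ y = g :=
  (isProjective_iff.mp hP h).2 g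

theorem of_retract (hP : ξ.IsProjective P) {Q : C} (i : Q ⟶ P) (r : P ⟶ Q)
    (h : i ≫ r = 𝟙 Q) : ξ.IsProjective Q := by
  rw [isProjective_iff]
  intro A B D x y δ hm
  refine ⟨fun f hf => ?_, fun g => ?_⟩
  · have := hP.eq_zero hm (r ≫ f) (by simp [hf])
    rw [← Category.id_comp f, ← h, Category.assoc, this, comp_zero]
  · obtain ⟨f, hf⟩ := hP.exists_lift hm (r ≫ g)
    exact ⟨i ≫ f, by rw [Category.assoc, hf, reassoc_of% h]⟩

theorem sigma {J : Type*} (Q : J → C) [HasCoproduct Q] (hQ : ∀ j, ξ.IsProjective (Q j)) :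
    ξ.IsProjective (∐ Q) := by
  rw [isProjective_iff]
  intro A B D x y δ hm
  refine ⟨fun f hf => ?_, fun g => ?_⟩
  · refine Sigma.hom_ext _ _ fun j => ?_
    rw [IsProjective.eq_zero (hQ j) hm (Sigma.ι Q j ≫ f) (by simp [hf]), comp_zero]
  · choose f hf using fun j => IsProjective.exists_lift (hQ j) hm (Sigma.ι Q j ≫ g)
    exact ⟨Sigma.desc f, Sigma.hom_ext _ _ fun j => by simp [hf]⟩

end IsProjective

namespace IsInjective

variable {I A B D : C} {x : A ⟶ B} {y : B ⟶ D} {δ : Extn S.E D A}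

theorem eq_zero (hI : ξ.IsInjective I) (h : ξ.mem x y δ) (f : D ⟶ I) (hf : y ≫ f = 0) :
    f = 0 :=
  (hI x y δ h).1 (by simpa using hf)

theorem exists_extend (hI : ξ.IsInjective I) (h : ξ.mem x y δ) (g : A ⟶ I) :
    ∃ f : B ⟶ I, x ≫ f = g :=
  (hI x y δ h).2.2 g

end IsInjective

end Projective

/-! ### Detecting isomorphisms on projectives and on injectives. -/

section Conservative

variable {C : Type u} [Category.{v} C] [Preadditive C] [HasZeroObject C] [HasBinaryBiproducts C]
variable {S : Extriangulation.{w} C} {ξ : S.ProperClass}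

/-- The `ξ`-injectives cogenerate as soon as the `ξ`-projectives generate. -/
theorem ProjectivesGenerate.isZero_of_injective (hgen : ξ.ProjectivesGenerate)
    (hinj : ξ.EnoughInjectives) (A : C)
    (h : ∀ I : C, ξ.IsInjective I → ∀ f : A ⟶ I, f = 0) : IsZero A := by
  obtain ⟨I, L, x, y, δ, hm, hI⟩ := hinj A
  exact hgen A fun P hP f => hP.eq_zero hm f (by rw [h I hI x, comp_zero])

/-- As `g` itself need not be an inflation or a deflation, it is replaced by the deflation `(g, π) :
A ⊞ P ⟶ B` with `π : P ⟶ B` a `ξ`-deflation. Its kernel `L` acts as a pullback of `g` along `π`; the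
projection `L ⟶ P` is a split epimorphism whose kernel `N` is invisible to projectives, hence zero.
-/
theorem exists_retraction_of_bijective_projective (hWIC : S.WIC) (hproj : ξ.EnoughProjectives)
    (hgen : ξ.ProjectivesGenerate) {A B : C} (g : A ⟶ B)
    (hg₁ : ∀ P : C, ξ.IsProjective P → ∀ t : P ⟶ A, t ≫ g = 0 → t = 0)
    (hg₂ : ∀ P : C, ξ.IsProjective P → ∀ t : P ⟶ B, ∃ s : P ⟶ A, s ≫ g = t) :
    ∃ k : B ⟶ A, g ≫ k = 𝟙 A := by
  obtain ⟨K, P, x, π, ε, hm, hP⟩ := hproj B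
  obtain ⟨L, l, δ, hl⟩ := exists_mem_of_comp_deflation hWIC (biprod.inr : P ⟶ A ⊞ P)
    (biprod.desc g π) (x := x) (δ := ε) (by simpa using hm)
  have hlz := (ξ.isTriangle hl).comp_eq_zero
  have hq₁ : ∀ Q : C, ξ.IsProjective Q → ∀ t : Q ⟶ L, t ≫ l ≫ biprod.snd = 0 → t = 0 := by
    intro Q hQ t ht
    refine hQ.eq_zero hl t ?_
    have h₀ : t ≫ l = (t ≫ l ≫ biprod.fst) ≫ biprod.inl := by
      ext <;> simp [ht]
    have h₁ : t ≫ l ≫ biprod.fst = 0 := by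
      refine hg₁ Q hQ _ ?_
      have h₂ : (t ≫ l) ≫ biprod.desc g π = 0 := by rw [Category.assoc, hlz, comp_zero]
      rw [h₀] at h₂
      simpa using h₂
    rw [h₀, h₁, zero_comp]
  obtain ⟨s, hs⟩ := hg₂ P hP π
  obtain ⟨r, hr⟩ := (ξ.isTriangle hl).exists_lift (biprod.lift (-s) (𝟙 P)) (by simp [hs])
  have hrq : r ≫ l ≫ biprod.snd = 𝟙 P := by rw [reassoc_of% hr]; simp
  obtain ⟨N, n, ν, hn⟩ := exists_mem_of_section (ξ := ξ) hWIC _ _ hrq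
  have hN : IsZero N := hgen N fun Q hQ f => hQ.eq_zero hn f
    (hq₁ Q hQ _ (by rw [Category.assoc, (ξ.isTriangle hn).comp_eq_zero, comp_zero]))
  obtain ⟨t, ht⟩ := (ξ.isTriangle hn).exists_lift ((l ≫ biprod.snd) ≫ r - 𝟙 L)
    (by simp [hrq])
  have hqr : (l ≫ biprod.snd) ≫ r = 𝟙 L := by
    rw [hN.eq_zero_of_tgt t, zero_comp] at ht
    exact sub_eq_zero.mp ht.symm
  -- With `L ≅ P`, this map `A ⊞ P ⟶ A` kills `L` and is the identity on `A`, so it descends to the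
  -- retraction.
  obtain ⟨k, hk⟩ := (ξ.isTriangle hl).exists_desc
    (biprod.fst - biprod.snd ≫ r ≫ l ≫ biprod.fst) (by
      rw [Preadditive.comp_sub, ← Category.assoc l biprod.snd, ← Category.assoc _ r, hqr,
        Category.id_comp, sub_self])
  exact ⟨k, by simpa using biprod.inl ≫= hk⟩

/-- A morphism which is seen as bijective by all `ξ`-projectives is an isomorphism. -/
theorem isIso_of_bijective_projective (hWIC : S.WIC) (hproj : ξ.EnoughProjectives)
    (hgen : ξ.ProjectivesGenerate) {A B : C} (g : A ⟶ B)
    (hg₁ : ∀ P : C, ξ.IsProjective P → ∀ t : P ⟶ A, t ≫ g = 0 → t = 0)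
    (hg₂ : ∀ P : C, ξ.IsProjective P → ∀ t : P ⟶ B, ∃ s : P ⟶ A, s ≫ g = t) : IsIso g := by
  obtain ⟨k, hk⟩ := exists_retraction_of_bijective_projective hWIC hproj hgen g hg₁ hg₂
  obtain ⟨l, hl⟩ := exists_retraction_of_bijective_projective hWIC hproj hgen k
    (fun P hP t ht => by
      obtain ⟨s, rfl⟩ := hg₂ P hP t
      rw [Category.assoc, hk, Category.comp_id] at ht
      rw [ht, zero_comp])
    (fun P _ t => ⟨t ≫ g, by rw [Category.assoc, hk, Category.comp_id]⟩)
  have : l = g := by rw [← Category.id_comp l, ← hk, Category.assoc, hl, Category.comp_id]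
  exact ⟨k, hk, this ▸ hl⟩

/-- Dual argument, with the inflation `(g, π) : A ⟶ B ⊞ I`; the cokernel `N` vanishes because
injectives cogenerate. -/
theorem exists_section_of_bijective_injective (hWIC : S.WIC) (hinj : ξ.EnoughInjectives)
    (hgen : ξ.ProjectivesGenerate) {A B : C} (g : A ⟶ B)
    (hg₁ : ∀ I : C, ξ.IsInjective I → ∀ t : B ⟶ I, g ≫ t = 0 → t = 0)
    (hg₂ : ∀ I : C, ξ.IsInjective I → ∀ t : A ⟶ I, ∃ s : B ⟶ I, g ≫ s = t) :
    ∃ k : B ⟶ A, k ≫ g = 𝟙 B := by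
  obtain ⟨I, K, π, y, ε, hm, hI⟩ := hinj A
  obtain ⟨L, l, δ, hl⟩ := exists_mem_of_comp_inflation hWIC (biprod.lift g π)
    (biprod.snd : B ⊞ I ⟶ I) (y := y) (δ := ε) (by simpa using hm)
  have hlz := (ξ.isTriangle hl).comp_eq_zero
  have hq₁ : ∀ J : C, ξ.IsInjective J → ∀ t : L ⟶ J, (biprod.inr ≫ l) ≫ t = 0 → t = 0 := by
    intro J hJ t ht
    refine hJ.eq_zero hl t ?_
    have h₀ : l ≫ t = biprod.fst ≫ biprod.inl ≫ l ≫ t := by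
      ext
      · simp
      · simpa using ht
    have h₁ : biprod.inl ≫ l ≫ t = 0 := by
      refine hg₁ J hJ _ ?_
      have h₂ : biprod.lift g π ≫ l ≫ t = 0 := by rw [reassoc_of% hlz, zero_comp]
      rw [h₀] at h₂
      simpa using h₂
    rw [h₀, h₁, comp_zero]
  obtain ⟨s, hs⟩ := hg₂ I hI π
  obtain ⟨r, hr⟩ := (ξ.isTriangle hl).exists_desc (biprod.desc (-s) (𝟙 I)) (by simp [hs])
  have hrq : (biprod.inr ≫ l) ≫ r = 𝟙 I := by rw [Category.assoc, hr]; simp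
  obtain ⟨N, n, ν, hn⟩ := exists_mem_of_retraction (ξ := ξ) hWIC _ _ hrq
  have hN : IsZero N := hgen.isZero_of_injective hinj N fun J hJ f => hJ.eq_zero hn f
    (hq₁ J hJ _ (by rw [← Category.assoc, (ξ.isTriangle hn).comp_eq_zero, zero_comp]))
  obtain ⟨t, ht⟩ := (ξ.isTriangle hn).exists_desc (r ≫ (biprod.inr ≫ l) - 𝟙 L)
    (by rw [Preadditive.comp_sub, ← Category.assoc _ r, hrq]; simp)
  have hqr : r ≫ biprod.inr ≫ l = 𝟙 L := by
    rw [hN.eq_zero_of_src t, comp_zero] at ht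
    exact sub_eq_zero.mp ht.symm
  obtain ⟨k, hk⟩ := (ξ.isTriangle hl).exists_lift
    (biprod.inl - biprod.inl ≫ l ≫ r ≫ biprod.inr) (by
      simp only [Preadditive.sub_comp, Category.assoc, hqr, Category.comp_id, sub_self])
  exact ⟨k, by simpa using hk =≫ biprod.fst⟩

/-- A morphism which is seen as bijective by all `ξ`-injectives is an isomorphism. -/
theorem isIso_of_bijective_injective (hWIC : S.WIC) (hinj : ξ.EnoughInjectives)
    (hgen : ξ.ProjectivesGenerate) {A B : C} (g : A ⟶ B)
    (hg₁ : ∀ I : C, ξ.IsInjective I → ∀ t : B ⟶ I, g ≫ t = 0 → t = 0)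
    (hg₂ : ∀ I : C, ξ.IsInjective I → ∀ t : A ⟶ I, ∃ s : B ⟶ I, g ≫ s = t) : IsIso g := by
  obtain ⟨k, hk⟩ := exists_section_of_bijective_injective hWIC hinj hgen g hg₁ hg₂
  obtain ⟨l, hl⟩ := exists_section_of_bijective_injective hWIC hinj hgen k
    (fun I hI t ht => by
      obtain ⟨s, rfl⟩ := hg₂ I hI t
      rw [reassoc_of% hk] at ht
      rw [ht, comp_zero])
    (fun I _ t => ⟨g ≫ t, by rw [reassoc_of% hk]⟩)
  have : l = g := by rw [← Category.comp_id l, ← hk, reassoc_of% hl]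
  exact ⟨k, this ▸ hl, hk⟩

end Conservative

/-! ### `ξxt¹` through short projective presentations. -/

section Resolutions

variable {C : Type u} [Category.{v} C] [Preadditive C] [HasZeroObject C] [HasBinaryBiproducts C]
variable {S : Extriangulation.{w} C} {ξ : S.ProperClass}

theorem ProjRes.subsingleton_Xt_one_iff {M : C} (R : ξ.ProjRes M) (N : C) :
    Subsingleton (R.Xt N 1) ↔
      ∀ f : R.P 1 ⟶ N, R.d 1 ≫ f = 0 → ∃ h : R.P 0 ⟶ N, R.d 0 ≫ h = f := by
  constructor
  · intro h f hf
    let c : R.cocycles N 1 := ⟨f, hf⟩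
    have hc : (QuotientAddGroup.mk c : R.Xt N 1) = 0 := Subsingleton.elim _ _
    rw [QuotientAddGroup.eq_zero_iff] at hc
    exact hc
  · intro h
    refine subsingleton_of_forall_eq 0 fun z => ?_
    obtain ⟨⟨f, hf⟩, rfl⟩ := QuotientAddGroup.mk_surjective z
    rw [QuotientAddGroup.eq_zero_iff]
    exact h f hf

/-- Splicing a `ξ`-triangle `K ⟶ P ⟶ M ⇢` with `P` `ξ`-projective and a resolution of `K`. -/
def ProjRes.cons {K P M : C} {i : K ⟶ P} {p : P ⟶ M} {δ : Extn S.E M K} (h : ξ.mem i p δ)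
    (hP : ξ.IsProjective P) (R : ξ.ProjRes K) : ξ.ProjRes M where
  P n := Nat.casesOn n P R.P
  K n := Nat.casesOn n K R.K
  projective n := by
    cases n
    · exact hP
    · exact R.projective _
  i n := Nat.casesOn n i R.i
  augm := p
  δ_augm := δ
  mem_augm := h
  p n := Nat.casesOn n R.augm R.p
  δ n := Nat.casesOn n R.δ_augm R.δ
  mem_p n := by
    cases n
    · exact R.mem_augm
    · exact R.mem_p _

/-- Given a `ξ`-projective presentation `i : P₁ ⟶ P₀` of an object `M` with
`ξxt¹(M, N) = 0`, all morphisms `P₁ ⟶ N` extend to `P₀`. -/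
theorem XtZero.exists_extend (hproj : ξ.EnoughProjectives) {P₁ P₀ M N : C} {i : P₁ ⟶ P₀}
    {p : P₀ ⟶ M} {δ : Extn S.E M P₁} (h : ξ.mem i p δ) (hP₀ : ξ.IsProjective P₀)
    (hP₁ : ξ.IsProjective P₁) (hN : ξ.XtZero 1 M N) (g : P₁ ⟶ N) :
    ∃ f : P₀ ⟶ N, i ≫ f = g := by
  obtain ⟨R⟩ := ProjRes.nonempty_of_enough ξ hproj P₁
  obtain ⟨f, hf⟩ := ((ProjRes.cons h hP₀ R).subsingleton_Xt_one_iff N).mp (hN _) (R.augm ≫ g) (by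
    change (R.p 0 ≫ R.i 0) ≫ R.augm ≫ g = 0
    rw [Category.assoc, reassoc_of% (ξ.isTriangle R.mem_augm).comp_eq_zero, zero_comp, comp_zero])
  change P₀ ⟶ N at f
  change (R.augm ≫ i) ≫ f = R.augm ≫ g at hf
  -- The augmentation `R.P 0 ⟶ P₁` splits as `P₁` is projective, so it can be cancelled.
  obtain ⟨s, hs⟩ := hP₁.exists_lift R.mem_augm (𝟙 P₁)
  refine ⟨f, ?_⟩
  simpa [reassoc_of% hs] using s ≫= hf

/-- If all morphisms `P₁ ⟶ N` extend along some `ξ`-projective presentation `P₁ ⟶ P₀` of `M`,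
then `ξxt¹(M, N) = 0`. -/
theorem XtZero.of_exists_extend {P₁ P₀ M N : C} {i : P₁ ⟶ P₀}
    {p : P₀ ⟶ M} {δ : Extn S.E M P₁} (h : ξ.mem i p δ) (hP₀ : ξ.IsProjective P₀)
    (hP₁ : ξ.IsProjective P₁) (hN : ∀ g : P₁ ⟶ N, ∃ f : P₀ ⟶ N, i ≫ f = g) :
    ξ.XtZero 1 M N := by
  intro R
  rw [ProjRes.subsingleton_Xt_one_iff]
  intro f hf
  -- Comparison maps `a`, `b`, `β` into `R` and `a'`, `b'` back; `σ` is the homotopy from `a' ≫ a`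
  -- to the identity in degree `0`.
  obtain ⟨a, ha⟩ := hP₀.exists_lift R.mem_augm p
  obtain ⟨a', ha'⟩ := IsProjective.exists_lift (R.projective 0) h R.augm
  obtain ⟨b, hb⟩ := (ξ.isTriangle R.mem_augm).exists_lift (i ≫ a)
    (by rw [Category.assoc, ha, (ξ.isTriangle h).comp_eq_zero])
  obtain ⟨b', hb'⟩ := (ξ.isTriangle h).exists_lift (R.i 0 ≫ a')
    (by rw [Category.assoc, ha', (ξ.isTriangle R.mem_augm).comp_eq_zero])
  obtain ⟨β, hβ⟩ := hP₁.exists_lift (R.mem_p 0) b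
  obtain ⟨s, hs⟩ := (ξ.isTriangle R.mem_augm).exists_lift (a' ≫ a - 𝟙 _)
    (by rw [Preadditive.sub_comp, Category.assoc, ha, ha', Category.id_comp, sub_self])
  obtain ⟨σ, hσ⟩ := IsProjective.exists_lift (R.projective 0) (R.mem_p 0) s
  obtain ⟨k, hk⟩ := hN (β ≫ f)
  -- The homotopy relation in degree `1`. It is checked after `R.i 0`, which is cancellable here
  -- because `R.P 1` is projective; the difference then factors through `R.d 1`, which `f` kills.
  have key : (R.p 0 ≫ b' ≫ β - R.p 0 ≫ R.i 0 ≫ σ - 𝟙 (R.P 1)) ≫ R.p 0 = 0 := by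
    refine IsProjective.eq_zero (R.projective 1) R.mem_augm _ ?_
    simp only [Preadditive.sub_comp, Category.assoc, reassoc_of% hβ, reassoc_of% hσ, hb, hs,
      reassoc_of% hb', Preadditive.comp_sub, Category.comp_id, Category.id_comp]
    abel
  obtain ⟨t, ht⟩ := (ξ.isTriangle (R.mem_p 0)).exists_lift _ key
  obtain ⟨τ, hτ⟩ := IsProjective.exists_lift (R.projective 1) (R.mem_p 1) t
  have hz : (R.p 0 ≫ b' ≫ β - R.p 0 ≫ R.i 0 ≫ σ - 𝟙 (R.P 1)) ≫ f = 0 := by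
    rw [← ht, ← hτ, Category.assoc, Category.assoc, ← Category.assoc (R.p 1)]
    change τ ≫ R.d 1 ≫ f = 0
    rw [hf, comp_zero]
  refine ⟨a' ≫ k - σ ≫ f, ?_⟩
  simp only [Preadditive.sub_comp, Category.assoc, Category.id_comp] at hz
  rw [← sub_eq_zero, ← hz]
  simp only [ProjRes.d, Preadditive.comp_sub, Category.assoc, ← reassoc_of% hb', hk]

end Resolutions

/-! ### Coproducts of `ξ`-triangles. -/

section Coproducts

variable {C : Type u} [Category.{v} C] [Preadditive C] [HasZeroObject C] [HasBinaryBiproducts C]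
variable {S : Extriangulation.{w} C} {ξ : S.ProperClass}

/-- Coproducts of triangles in `ξ` belong to `ξ`. -/
theorem exists_mem_sigma (hWIC : S.WIC) (hinj : ξ.EnoughInjectives)
    (hgen : ξ.ProjectivesGenerate) {J : Type*} {A B D : J → C} [HasCoproduct A] [HasCoproduct B]
    [HasCoproduct D] (x : ∀ j, A j ⟶ B j) (y : ∀ j, B j ⟶ D j)
    (δ : ∀ j, Extn S.E (D j) (A j)) (h : ∀ j, ξ.mem (x j) (y j) (δ j)) :
    ∃ ε : Extn S.E (∐ D) (∐ A), ξ.mem (Limits.Sigma.map x) (Limits.Sigma.map y) ε := by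
  obtain ⟨I, L, u, _, _, hu, hI⟩ := hinj (∐ A)
  choose f hf using fun j => hI.exists_extend (h j) (Sigma.ι A j ≫ u)
  have hfu : Limits.Sigma.map x ≫ Sigma.desc f = u :=
    Sigma.hom_ext _ _ fun j => by simp [hf]
  rw [← hfu] at hu
  -- The coproduct of the `x j` is a `ξ`-inflation because a `ξ`-inflation into an injective factors
  -- through it. It remains to identify its cokernel `Z` with `∐ D`, which is tested on injectives
  -- one summand at a time.
  obtain ⟨Z, z, ε, hz⟩ := exists_mem_of_comp_inflation hWIC _ _ hu
  have hxz := (ξ.isTriangle hz).comp_eq_zero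
  choose τ hτ using fun j => (ξ.isTriangle (h j)).exists_desc (Sigma.ι B j ≫ z) (by
    have := Sigma.ι A j ≫= hxz
    simpa using this)
  have hyτ : Limits.Sigma.map y ≫ Sigma.desc τ = z :=
    Sigma.hom_ext _ _ fun j => by simp [hτ]
  have hxy : Limits.Sigma.map x ≫ Limits.Sigma.map y = 0 :=
    Sigma.hom_ext _ _ fun j => by simp [reassoc_of% (ξ.isTriangle (h j)).comp_eq_zero]
  have : IsIso (Sigma.desc τ) := by
    refine isIso_of_bijective_injective hWIC hinj hgen _ (fun I' hI' t ht => ?_)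
      (fun I' hI' t => ?_)
    · exact hI'.eq_zero hz t (by rw [← hyτ, Category.assoc, ht, comp_zero])
    · obtain ⟨s, hs⟩ := (ξ.isTriangle hz).exists_desc (Limits.Sigma.map y ≫ t)
        (by rw [reassoc_of% hxy, zero_comp])
      refine ⟨s, Sigma.hom_ext _ _ fun j => sub_eq_zero.mp (hI'.eq_zero (h j) _ ?_)⟩
      have := Sigma.ι B j ≫= hs
      simp only [Sigma.ι_map_assoc] at this
      simp [Preadditive.comp_sub, reassoc_of% (hτ j), this]
  have hm := mem_of_iso_right hz (asIso (Sigma.desc τ))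
  have hy : z ≫ (asIso (Sigma.desc τ)).inv = Limits.Sigma.map y := by simp [← hyτ]
  rw [hy] at hm
  exact ⟨_, hm⟩

end Coproducts

/-! ### The class `T^⊥` and the universal extension. -/

section Perp

variable {C : Type u} [Category.{v} C] [Preadditive C] [HasZeroObject C] [HasBinaryBiproducts C]
variable {S : Extriangulation.{w} C} {ξ : S.ProperClass}

theorem perp_iff (hproj : ξ.EnoughProjectives) {P₁ P₀ T : C} {i : P₁ ⟶ P₀} {p : P₀ ⟶ T}
    {δ : Extn S.E T P₁} (h : ξ.mem i p δ) (hP₀ : ξ.IsProjective P₀) (hP₁ : ξ.IsProjective P₁)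
    (Y : C) : ξ.perp T Y ↔ ∀ g : P₁ ⟶ Y, ∃ f : P₀ ⟶ Y, i ≫ f = g := by
  constructor
  · intro hY
    exact XtZero.exists_extend hproj h hP₀ hP₁ (hY T rfl)
  · rintro hY _ rfl
    exact XtZero.of_exists_extend h hP₀ hP₁ hY

theorem isSubcategory_perp (hproj : ξ.EnoughProjectives) {T : C} (hT : ξ.PdLE 1 T) :
    IsSubcategory (ξ.perp T) := by
  obtain ⟨P₁, P₀, i, p, δ, h, hP₀, hP₁⟩ := hT
  have key := perp_iff hproj h hP₀ hP₁
  have retract : ∀ {X Y : C} (s : X ⟶ Y) (r : Y ⟶ X), s ≫ r = 𝟙 X →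
      ξ.perp T Y → ξ.perp T X := by
    intro X Y s r hsr hY
    rw [key] at hY ⊢
    intro g
    obtain ⟨f, hf⟩ := hY (g ≫ s)
    exact ⟨f ≫ r, by rw [reassoc_of% hf, hsr, Category.comp_id]⟩
  refine ⟨fun Z hZ => ?_, fun e => retract e.inv e.hom (by simp), fun {X Y} hX hY => ?_,
    retract biprod.inl biprod.fst (by simp)⟩
  · rw [key]
    exact fun g => ⟨0, hZ.eq_of_tgt _ _⟩
  · rw [key] at hX hY ⊢
    intro g
    obtain ⟨f₁, hf₁⟩ := hX (g ≫ biprod.fst)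
    obtain ⟨f₂, hf₂⟩ := hY (g ≫ biprod.snd)
    exact ⟨biprod.lift f₁ f₂, by ext <;> simp [hf₁, hf₂]⟩

theorem perp_of_isInjective (hproj : ξ.EnoughProjectives) {T : C} (hT : ξ.PdLE 1 T) {I : C}
    (hI : ξ.IsInjective I) : ξ.perp T I := by
  obtain ⟨P₁, P₀, i, p, δ, h, hP₀, hP₁⟩ := hT
  rw [perp_iff hproj h hP₀ hP₁]
  exact hI.exists_extend h

/-- For `T` of `ξ`-projective dimension at most one, `T^⊥` is closed under `ξ`-quotients. -/
theorem perp_of_mem (hproj : ξ.EnoughProjectives) {T : C} (hT : ξ.PdLE 1 T) {X Y Z : C}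
    {x : X ⟶ Y} {y : Y ⟶ Z} {ε : Extn S.E Z X} (hm : ξ.mem x y ε) (hY : ξ.perp T Y) :
    ξ.perp T Z := by
  obtain ⟨P₁, P₀, i, p, δ, h, hP₀, hP₁⟩ := hT
  rw [perp_iff hproj h hP₀ hP₁] at hY ⊢
  intro g
  obtain ⟨g', hg'⟩ := hP₁.exists_lift hm g
  obtain ⟨f, hf⟩ := hY g'
  exact ⟨f ≫ y, by rw [reassoc_of% hf, hg']⟩

/-- Here `R.K 0` is the first syzygy of `K` and `R.K 1` the second. The aim is to split `R.i 1 : R.K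
1 ⟶ R.P 1`, so that `R.K 0` becomes a summand of `R.P 1`. -/
theorem pdLE_one_of_leftPerp_perp (hWIC : S.WIC) (hproj : ξ.EnoughProjectives)
    (hinj : ξ.EnoughInjectives) (hgen : ξ.ProjectivesGenerate) {T : C} (hT : ξ.PdLE 1 T) {K : C}
    (hK : ξ.leftPerp (ξ.perp T) K) : ξ.PdLE 1 K := by
  obtain ⟨R⟩ := ProjRes.nonempty_of_enough ξ hproj K
  obtain ⟨I, L, j, l, ε, hj, hI⟩ := hinj (R.K 1)
  have hL := perp_of_mem hproj hT hj (perp_of_isInjective hproj hT hI)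
  obtain ⟨m, hm⟩ := hI.exists_extend (R.mem_p 0) j
  have hjl := (ξ.isTriangle hj).comp_eq_zero
  -- The cocycle `m ≫ l` is a coboundary; lifting the bounding map to `I` corrects `m` to a map that
  -- factors through `R.K 1`.
  obtain ⟨n, hn⟩ := (R.subsingleton_Xt_one_iff L).mp (hK L hL R) (m ≫ l)
    (by rw [ProjRes.d, Category.assoc, reassoc_of% hm, hjl, comp_zero])
  obtain ⟨n', rfl⟩ := IsProjective.exists_lift (R.projective 0) hj n
  obtain ⟨h, hh⟩ := (ξ.isTriangle hj).exists_lift (m - R.d 0 ≫ n')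
    (by rw [Preadditive.sub_comp, Category.assoc, hn, sub_self])
  have hij : (R.i 1 ≫ h) ≫ j = j := by
    rw [Category.assoc, hh, Preadditive.comp_sub, hm, ProjRes.d, Category.assoc,
      reassoc_of% (ξ.isTriangle (R.mem_p 0)).comp_eq_zero, zero_comp, sub_zero]
  -- As `j` need not be monic, `R.i 1 ≫ h` is only seen to be the identity by projectives; this
  -- suffices for it to be an isomorphism.
  have hid : ∀ Q : C, ξ.IsProjective Q → ∀ t : Q ⟶ R.K 1, t ≫ R.i 1 ≫ h = t := by
    intro Q hQ t
    refine sub_eq_zero.mp (hQ.eq_zero hj _ ?_)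
    rw [Preadditive.sub_comp, Category.assoc, hij, sub_self]
  have : IsIso (R.i 1 ≫ h) := isIso_of_bijective_projective hWIC hproj hgen _
    (fun Q hQ t ht => by rwa [hid Q hQ] at ht) (fun Q hQ t => ⟨t, hid Q hQ t⟩)
  obtain ⟨s, hs⟩ := (ξ.isTriangle (R.mem_p 0)).exists_section (r := h ≫ inv (R.i 1 ≫ h))
    (by rw [← Category.assoc, IsIso.hom_inv_id])
  exact ⟨_, _, _, _, _, R.mem_augm, R.projective 0, IsProjective.of_retract (R.projective 1) s (R.p 0) hs⟩

variable [HasCoproducts.{v} C]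

/-- The universal extension of copies of `T` by `M`. -/
theorem IsTilting.exists_triangle (hWIC : S.WIC) (hproj : ξ.EnoughProjectives)
    (hinj : ξ.EnoughInjectives) (hgen : ξ.ProjectivesGenerate) {T : C} (hT : ξ.IsTilting T)
    (M : C) : ∃ (X₀ K : C) (x : M ⟶ X₀) (y : X₀ ⟶ K) (δ : Extn S.E K M),
      ξ.mem x y δ ∧ ξ.perp T X₀ ∧
      (∀ X : C, ξ.perp T X → Function.Surjective (fun f : X₀ ⟶ X => x ≫ f)) ∧
      ξ.leftPerp (ξ.perp T) K := by
  obtain ⟨P₁, P₀, i, p, δ, h, hP₀, hP₁⟩ := hT.pd_le_one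
  have key := perp_iff hproj h hP₀ hP₁
  let J : Type v := P₁ ⟶ M
  obtain ⟨ε, hε⟩ := exists_mem_sigma hWIC hinj hgen (fun _ : J => i) (fun _ => p) (fun _ => δ)
    (fun _ => h)
  have extend : ∀ X : C, ξ.perp T X → ∀ g : (∐ fun _ : J => P₁) ⟶ X,
      ∃ f : (∐ fun _ : J => P₀) ⟶ X, Limits.Sigma.map (fun _ : J => i) ≫ f = g := by
    intro X hX g
    choose f hf using fun j : J => (key X).mp hX (Sigma.ι (fun _ : J => P₁) j ≫ g)
    exact ⟨Sigma.desc f, Sigma.hom_ext _ _ fun j => by simp [hf]⟩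
  let ev : (∐ fun _ : J => P₁) ⟶ M := Sigma.desc fun j : J => j
  obtain ⟨X₀, x, y, hxy⟩ := S.exists_isTriangle (push S.E ev ε)
  have hm := ξ.cobase_change ev hε hxy
  refine ⟨X₀, _, x, y, _, hm, ?_, fun X hX f => ?_, fun X hX => ?_⟩
  · rw [key]
    intro g
    obtain ⟨k, hk⟩ := XtZero.exists_extend hproj h hP₀ hP₁ (hT.self_orthogonal J) (g ≫ y)
    obtain ⟨k', rfl⟩ := hP₀.exists_lift hm k
    -- The remainder `t : P₁ ⟶ M` is itself an index in `J`, and the component of `e` at `t` extends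
    -- `t ≫ x` along `i`.
    obtain ⟨t, ht⟩ := hxy.exists_lift (g - i ≫ k')
      (by rw [Preadditive.sub_comp, Category.assoc, hk, sub_self])
    obtain ⟨e, he⟩ := (ξ.isTriangle hε).exists_extend (ev ≫ x)
      (by rw [push_comp, hxy.push_eq_zero])
    have hte : i ≫ Sigma.ι (fun _ : J => P₀) t ≫ e = t ≫ x := by
      have := Sigma.ι (fun _ : J => P₁) t ≫= he
      simpa [ev] using this
    exact ⟨k' + Sigma.ι (fun _ : J => P₀) t ≫ e, by
      rw [Preadditive.comp_add, hte, ht, add_sub_cancel]⟩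
  -- Extending `ev ≫ f` to `∐ P₀` makes `f_*(ev_* ε)` vanish, which is the obstruction to extending
  -- `f` along `x`.
  · obtain ⟨e, he⟩ := extend X hX (ev ≫ f)
    refine hxy.exists_extend f ?_
    rw [← push_comp, ← he, (ξ.isTriangle hε).push_extend]
  -- The third term is `∐ T`, presented by the coproduct triangle.
  · exact XtZero.of_exists_extend hε (IsProjective.sigma _ fun _ => hP₀)
      (IsProjective.sigma _ fun _ => hP₁) (extend X hX)

end Perp

end ProperClass

end Extriangulation

theorem proposition3p7 {C : Type u} [Category.{v} C] [Preadditive C]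
    [HasZeroObject C] [HasBinaryBiproducts C]
    [HasCoproducts.{v} C] (S : Extriangulation.{w} C) (hWIC : S.WIC) (ξ : S.ProperClass)
    (hproj : ξ.EnoughProjectives) (hinj : ξ.EnoughInjectives) (hgen : ξ.ProjectivesGenerate)
    (T : C) (hT : ξ.IsTilting T) :
    ξ.IsSpecialCovariantlyFinite (ξ.perp T) ∧
    (∀ K : C, ξ.leftPerp (ξ.perp T) K → ξ.PdLE 1 K) ∧
    (∀ {X Y Z : C} (x : X ⟶ Y) (y : Y ⟶ Z) (δ : Extn S.E Z X),
      ξ.mem x y δ → ξ.perp T X → ξ.perp T Y → ξ.perp T Z) :=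
  ⟨⟨Extriangulation.ProperClass.isSubcategory_perp hproj hT.pd_le_one,
      hT.exists_triangle hWIC hproj hinj hgen⟩,
    fun _ => Extriangulation.ProperClass.pdLE_one_of_leftPerp_perp hWIC hproj hinj hgen
      hT.pd_le_one,
    fun _ _ _ hm _ => Extriangulation.ProperClass.perp_of_mem hproj hT.pd_le_one hm⟩
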